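/- **Setting.** Let $F_o$ be a non-archimedean locally compact field of residual characteristic $\neq 2$, with valuation $v$ normalized by $v(F_o^\times)=\mathbb Z$; still write $v$ for its unique extension to finite extensions of $F_o$. Let $F/F_o$ be a Galois extension of degree $\le 2$, $\sigma_F$ the generator of $\mathrm{Gal}(F/F_o)$ (so $\sigma_F=\mathrm{id}$ if $F=F_o$), $\epsilon\in\{\pm1\}$, $V$ a finite-dimensional $F$-vector space and $h:V\times V\to F$ a non-degenerate $\epsilon$-hermitian form relative to $\sigma_F$: $h(\lambda x,\mu y)=\lambda^{\sigma_F}\mu\, h(x,y)$ and $h(y,x)=\epsilon\, h(x,y)^{\sigma_F}$. Let $a\mapsto a^{\sigma}$ be the adjoint involution of $\mathrm{End}_F(V)$, $h(ax,y)=h(x,a^\sigma y)$, and let $\mathfrak g=\{a\in \mathrm{End}_F(V): a+a^\sigma=0\}$ be the Lie algebra of the isometry group $G$ of $h$. Let $\beta\in\mathfrak g$, $\beta\ne0$, be such that $E:=F[\beta]\subset\mathrm{End}_F(V)$ is a field, let $\mathfrak h=\{a\in\mathfrak g: a\beta=\beta a\}$, let $\sigma_E$ be the restriction of $\sigma$ to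 $E$, and $E^o=\{e\in E:\sigma_E(e)=e\}$. For $K\in\{F,E\}$, an $\mathfrak o_K$-lattice function in $V$ is a map $\Lambda$ from $\mathbb R$ to the set of $\mathfrak o_K$-lattices in $V$ that is decreasing and left-continuous and satisfies $\Lambda(r+v(\pi_K))=\mathfrak p_K\Lambda(r)$ for all $r\in\mathbb R$, where $\pi_K$ is a uniformizer of $K$. If $h_K$ is a form on the $K$-vector space $V$, $\Lambda$ is self-dual for $h_K$ if $\Lambda(r)=\{x\in V: h_K(x,\bigcup_{s>-r}\Lambda(s))\subset\mathfrak p_K\}$ for all $r$; let $\mathrm{Latt}^1_{h_K}(V)$ be the set of these. Let $\lambda:E\to F$ be a non-zero $F$-linear form with $\lambda\circ\sigma_E=\sigma_F\circ\lambda$ such that the $F_o$-linear form $\lambda^o:E^o\to F_o$ with $\lambda^o\circ\mathrm{Tr}_{E/E^o}=\mathrm{Tr}_{F/F_o}\circ\lambda$ satisfies $\{e\in E^o:\lambda^o(e\,\mathfrak o_{E^o})\subset\mathfrak p_{F_o}\}=\mathfrak p_{E^o}$, and let $h_E:V\times V\to E$ be the $\epsilon$-hermitian form relative to $\sigma_E$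 with $h=\lambda\circ h_E$. The buildings of $G$ and of the centralizer $H$ of $\beta$ in $G$ are realized as $I=\mathrm{Latt}^1_h(V)$ and $I^1_\beta=\mathrm{Latt}^1_{h_E}(V)$. For $y\in I$, $x\in I^1_\beta$, corresponding to lattice functions $\Lambda_y$, $\Lambda_x$, and $r\in\mathbb R$, put $$\mathfrak g_{y,r}=\{a\in\mathfrak g: a\Lambda_y(s)\subset\Lambda_y(s+r)\ \forall s\in\mathbb R\},\qquad \mathfrak h_{x,r}=\{a\in\mathfrak h: a\Lambda_x(s)\subset\Lambda_x(s+r)\ \forall s\in\mathbb R\}.$$ **Theorem 11.2.** There is a well-defined map $j_\beta:I^1_\beta\to I$ sending $\Lambda$ to $\Lambda$ regarded as an $\mathfrak o_F$-lattice function. If $x\in I^1_\beta$ and $y\in I$ satisfy $\mathfrak g_{y,r}\cap\mathfrak h=\mathfrak h_{x,r}$ for all $r\in\mathbb R$, then $y=j_\beta(x)$. Consequently $j_\beta$ is characterized by compatibility with the Lie algebra filtrations: a map $j:I^1_\beta\to I$ satisfies $\mathfrak g_{j(x),r}\cap\mathfrak h=\mathfrak h_{x,r}$ for all $x\in I^1_\beta$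 and $r\in\mathbb R$ if and only if $j=j_\beta$. -/

import Mathlib

noncomputable section

namespace ClassicalBuilding

/-- The ring of integers `𝔬_K = {x | ‖x‖ ≤ 1}` of a non-archimedean normed field `K`. Its maximal
ideal `𝔭_K` is `IsLocalRing.maximalIdeal (𝔬 K)`, consisting of the `x` with `‖x‖ < 1`. -/
abbrev 𝔬 (K : Type*) [NormedField K] [IsUltrametricDist K] : ValuationSubring K :=
  (NormedField.valuation (K := K)).valuationSubring

/-- The common norm of the uniformizers of the (discretely valued) ground field `Fo`:
the largest value of the norm which is `< 1`. -/
def unifNorm (Fo : Type*) [NormedField Fo] : ℝ :=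
  sSup {t : ℝ | ∃ x : Fo, ‖x‖ < 1 ∧ t = ‖x‖}

/-- The additive valuation `v` on the nonzero elements of a normed extension `K` of `Fo`,
normalized so that `v` takes the value `1` at the uniformizers of `Fo`; that is,
`‖x‖ = (unifNorm Fo) ^ (val Fo x)` for `x ≠ 0`. -/
def val (Fo : Type*) [NormedField Fo] {K : Type*} [NormedField K] (x : K) : ℝ :=
  Real.logb (unifNorm Fo) ‖x‖

/-- `𝔬_K`-lattice functions in the `K`-vector space `V`, where `K` is an extension of `Fo`
and the valuation on `K` is normalized by `Fo`. -/
structure LatticeFunction (Fo : Type*) [NormedField Fo] (K : Type*) [NormedField K]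
    [IsUltrametricDist K] (V : Type*) [AddCommGroup V] [Module K V] where
  /-- the value `Λ(r)` of the lattice function -/
  toFun : ℝ → Submodule (𝔬 K) V
  /-- each `Λ(r)` is an `𝔬_K`-lattice: finitely generated over `𝔬_K`, and spanning `V` over `K` -/
  isLattice : ∀ r, Submodule.IsLattice K (toFun r)
  /-- `Λ(r) ⊆ Λ(s)` for `r ≥ s` -/
  antitone : Antitone toFun
  /-- `Λ(r + v(ϖ)) = 𝔭_K Λ(r)` for the uniformizers `ϖ` of `K` -/
  shift : ∀ ϖ : 𝔬 K, Irreducible ϖ → ∀ r,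
    toFun (r + val Fo (ϖ : K)) = IsLocalRing.maximalIdeal (𝔬 K) • toFun r
  /-- left continuity, the set of lattices being discrete -/
  leftContinuous : ∀ r, ∃ s < r, ∀ t, s < t → t ≤ r → toFun t = toFun r

/-- The underlying family of subsets of `V` of a lattice function. -/
def LatticeFunction.sets {Fo : Type*} [NormedField Fo] {K : Type*} [NormedField K]
    [IsUltrametricDist K] {V : Type*} [AddCommGroup V] [Module K V]
    (Λ : LatticeFunction Fo K V) (r : ℝ) : Set V :=
  (Λ.toFun r : Set V)

/-- `Λ(r+) = ⋃_{s > r} Λ(s)`. -/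
def LatticeFunction.plus {Fo : Type*} [NormedField Fo] {K : Type*} [NormedField K]
    [IsUltrametricDist K] {V : Type*} [AddCommGroup V] [Module K V]
    (Λ : LatticeFunction Fo K V) (r : ℝ) : Set V :=
  ⋃ s > r, Λ.sets s

/-- `h` is `ε`-hermitian relative to `τ`: `h(y, x) = ε τ(h(x, y))`. The form is `τ`-semilinear in
the first variable and linear in the second one. -/
def IsEpsHermitian {K : Type*} [Field K] {V : Type*} [AddCommGroup V] [Module K V]
    (ε : K) {τ : K →+* K} (h : V →ₛₗ[τ] V →ₗ[K] K) : Prop :=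
  ∀ x y, h y x = ε * τ (h x y)

/-- The dual `L^♯ = {x ∈ V | h(x, L) ⊆ 𝔭_K}`. -/
def dual {K : Type*} [NormedField K] {V : Type*} [AddCommGroup V] [Module K V]
    {τ : K →+* K} (h : V →ₛₗ[τ] V →ₗ[K] K) (L : Set V) : Set V :=
  {x | ∀ y ∈ L, ‖h x y‖ < 1}

/-- `Λ` is self-dual: `Λ = Λ^♯`, where `Λ^♯(r) = (Λ((-r)+))^♯`. -/
def LatticeFunction.IsSelfDual {Fo : Type*} [NormedField Fo] {K : Type*} [NormedField K]
    [IsUltrametricDist K] {V : Type*} [AddCommGroup V] [Module K V]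
    (Λ : LatticeFunction Fo K V) {τ : K →+* K} (h : V →ₛₗ[τ] V →ₗ[K] K) : Prop :=
  ∀ r, Λ.sets r = dual h (Λ.plus (-r))

/-- The (Bruhat-Tits) building of the isometry group of the nondegenerate `ε`-hermitian form `h`,
realized as the set `Latt¹_h(V)` of self-dual `𝔬_K`-lattice functions in `V`. -/
def Building (Fo : Type*) [NormedField Fo] {K : Type*} [NormedField K]
    [IsUltrametricDist K] {V : Type*} [AddCommGroup V] [Module K V]
    {τ : K →+* K} (h : V →ₛₗ[τ] V →ₗ[K] K) :=
  {Λ : LatticeFunction Fo K V // Λ.IsSelfDual h}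

/-- The Lie algebra `𝔤 = {a ∈ End_K(V) | a + a^σ = 0}` of the isometry group of `h`, where `a^σ`
is the adjoint of `a`, i.e. `h(a x, y) = h(x, a^σ y)`. -/
def lieAlg {K : Type*} [Field K] {V : Type*} [AddCommGroup V] [Module K V]
    {τ : K →+* K} (h : V →ₛₗ[τ] V →ₗ[K] K) : Set (Module.End K V) :=
  {a | ∀ x y, h (a x) y + h x (a y) = 0}

/-- The centralizer `𝔥` of `β` in `𝔤`. -/
def lieCentralizer {K : Type*} [Field K] {V : Type*} [AddCommGroup V] [Module K V]
    {τ : K →+* K} (h : V →ₛₗ[τ] V →ₗ[K] K) (β : Module.End K V) : Set (Module.End K V) :=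
  {a | a ∈ lieAlg h ∧ a * β = β * a}

/-- The endomorphisms `a` with `a Λ(s) ⊆ Λ(s + r)` for all real `s`, for a family `Λ` of
subsets of `V`. -/
def endFiltration {K : Type*} [Field K] {V : Type*} [AddCommGroup V] [Module K V]
    (Λ : ℝ → Set V) (r : ℝ) : Set (Module.End K V) :=
  {a | ∀ s, ∀ x ∈ Λ s, a x ∈ Λ (s + r)}

/-- The filtration `𝔤_{y,r} = {a ∈ 𝔤 | a Λ_y(s) ⊆ Λ_y(s + r) for all s}` of `𝔤` attached to a
point `y` of the building of `h`. -/
def gFiltration {Fo : Type*} [NormedField Fo] {K : Type*} [NormedField K]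
    [IsUltrametricDist K] {V : Type*} [AddCommGroup V] [Module K V]
    {τ : K →+* K} {h : V →ₛₗ[τ] V →ₗ[K] K} (y : Building Fo h) (r : ℝ) :
    Set (Module.End K V) :=
  lieAlg h ∩ endFiltration y.1.sets r

/-- The filtration `𝔥_{x,r} = {a ∈ 𝔥 | a Λ_x(s) ⊆ Λ_x(s + r) for all s}` of the centralizer `𝔥` of
`β`, attached to a point `x` of the building of the form `hE` over the extension `E`. -/
def hFiltration {Fo : Type*} [NormedField Fo] {F : Type*} [Field F]
    {E : Type*} [NormedField E] [IsUltrametricDist E]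
    {V : Type*} [AddCommGroup V] [Module F V] [Module E V]
    {τ : F →+* F} (h : V →ₛₗ[τ] V →ₗ[F] F) (β : Module.End F V)
    {τE : E →+* E} {hE : V →ₛₗ[τE] V →ₗ[E] E} (x : Building Fo hE) (r : ℝ) :
    Set (Module.End F V) :=
  lieCentralizer h β ∩ endFiltration x.1.sets r

/-- The subfield `E° = {e ∈ E | σ_E(e) = e}` of `E`. -/
abbrev fixedSubfield {Fo E : Type*} [Field Fo] [Field E] [Algebra Fo E] (σE : E ≃ₐ[Fo] E) :
    IntermediateField Fo E :=
  IntermediateField.fixedField (Subgroup.zpowers σE)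

/-- `lam : E → F` is an admissible linear form, used to pass from forms over `E` to forms over `F`:
it is a nonzero `F`-linear form, it is equivariant for `σ_E` and `σ`, and the (nonzero) `Fo`-linear
form `lamo : E° → Fo` with `lamo ∘ Tr_{E/E°} = Tr_{F/Fo} ∘ lam` satisfies
`{e ∈ E° | lamo(e 𝔬_{E°}) ⊆ 𝔭_{Fo}} = 𝔭_{E°}`. -/
def IsAdmissibleForm {Fo F E : Type*} [NormedField Fo] [NormedField F] [NormedField E]
    [Algebra Fo F] [Algebra F E] [Algebra Fo E]
    (σ : F ≃ₐ[Fo] F) (σE : E ≃ₐ[Fo] E) (lam : E →ₗ[F] F) : Prop :=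
  lam ≠ 0 ∧
  (∀ e, lam (σE e) = σ (lam e)) ∧
  ∃ lamo : fixedSubfield σE →ₗ[Fo] Fo,
    lamo ≠ 0 ∧
    (∀ e : E, lamo (Algebra.trace (fixedSubfield σE) E e) = Algebra.trace Fo F (lam e)) ∧
    ∀ e : fixedSubfield σE,
      (∀ u : fixedSubfield σE, ‖(u : E)‖ ≤ 1 → ‖lamo (e * u)‖ < 1) ↔ ‖(e : E)‖ < 1

end ClassicalBuilding

end

/-!
The map `jβ` restricts scalars. It preserves self-duality because `{e ∈ E | lam(e 𝔬_E) ⊆ 𝔭_F} = 𝔭_E`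
(`IsAdmissibleForm.forall_norm_lt_one_iff`). This follows from the property of `lamo` imposed on
`lam`, since `F / Fo` and `E / E°` have degree at most `2` and are tamely ramified, `2` being a unit.

For the uniqueness, let `x` and `y` induce the same filtration on `𝔥`. The element `β` is skew, so
`σ_E ≠ 1`, and all skew elements of `E` lie in `𝔥`. Each nonzero skew `e` shifts `Λ_x` by `v(e)`,
hence it shifts `Λ_y` by `v(e)` too. A symmetric element is `(e β) β⁻¹`, a product of two skew ones,
and `2` is a unit, so `Λ_y` is compatible with all of `E^×` (`smul_mem_of_forall_lieCentralizer`).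

An endomorphism `a` that commutes with `E` is recovered from `a - a^σ` and `β (a + a^σ)`, both in
`𝔥`. As filtrations of self-dual lattice functions are stable under `a ↦ a^σ`, the points `x` and
`y` induce the same filtration on the whole centralizer of `β`
(`mem_endFiltration_of_forall_lieCentralizer`). It contains the rank one operators
`w ↦ hE(u, w) v`. The largest `r` by which such an operator shifts a lattice function is the order
of `v` minus a constant depending on `u`, so `Λ_x` and `Λ_y` agree up to a translation by some `t`
(`LatticeFunction.exists_order_eq_add`). Duality replaces `t` by `-t`, hence `t = 0`
(`LatticeFunction.IsSelfDual.eq_of_order_eq_add`).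
-/

noncomputable section

namespace ClassicalBuilding

/-! ### Valuations on discretely valued fields -/

section Valuation

theorem isDiscreteValuationRing_integers {K : Type*} [NormedField K] [IsUltrametricDist K]
    [ProperSpace K] (hK : ∃ x : K, x ≠ 0 ∧ ‖x‖ < 1) : IsDiscreteValuationRing (𝔬 K) := by
  obtain ⟨x, hx0, hx1⟩ := hK
  let : NontriviallyNormedField K := .ofNormNeOne ⟨x, hx0, hx1.ne⟩
  let := NormedField.toValued (K := K)
  have hball : IsCompact (Valued.integer K : Set K) := by
    convert isCompact_closedBall (0 : K) 1
    ext y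
    simpa using Valued.integer.mem_iff
  have : CompactSpace (Valued.integer K) := isCompact_iff_compactSpace.1 hball
  have : (Valued.v : Valuation K NNReal).IsNontrivial := by
    refine ⟨x, ?_, ?_⟩
    · simpa using hx0
    · intro h
      rw [NormedField.v_eq_valuation, NormedField.valuation_apply] at h
      exact hx1.ne (by rw [← coe_nnnorm, h]; rfl)
  exact Valued.integer.isDiscreteValuationRing_of_compactSpace (K := K)

variable {K : Type*} [NormedField K] [IsUltrametricDist K]

theorem mem_integers {x : K} : x ∈ 𝔬 K ↔ ‖x‖ ≤ 1 := by
  rw [Valuation.mem_valuationSubring_iff, NormedField.valuation_apply, ← NNReal.coe_le_coe]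
  rfl

theorem isUnit_integers_iff {u : 𝔬 K} : IsUnit u ↔ ‖(u : K)‖ = 1 := by
  refine (Valuation.integer.integers
    (NormedField.valuation (K := K))).isUnit_iff_valuation_eq_one.trans ?_
  rw [← NNReal.coe_inj]
  rfl

theorem norm_lt_one_of_irreducible {ϖ : 𝔬 K} (h : Irreducible ϖ) : ‖(ϖ : K)‖ < 1 :=
  lt_of_le_of_ne (mem_integers.1 ϖ.2) fun h1 => h.not_isUnit (isUnit_integers_iff.2 h1)

theorem norm_le_norm_of_irreducible [IsDiscreteValuationRing (𝔬 K)] {ϖ : 𝔬 K}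
    (h : Irreducible ϖ) {x : K} (hx : ‖x‖ < 1) : ‖x‖ ≤ ‖(ϖ : K)‖ := by
  have hm : (⟨x, mem_integers.2 hx.le⟩ : 𝔬 K) ∈ IsLocalRing.maximalIdeal (𝔬 K) := by
    rw [IsLocalRing.mem_maximalIdeal, mem_nonunits_iff, isUnit_integers_iff]
    exact hx.ne
  rw [h.maximalIdeal_eq, Ideal.mem_span_singleton'] at hm
  obtain ⟨a, ha⟩ := hm
  have : x = a * ϖ := (congrArg Subtype.val ha).symm
  rw [this, norm_mul]
  exact mul_le_of_le_one_left (norm_nonneg _) (mem_integers.1 a.2)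

/-- The supremum that defines `unifNorm` is attained, at any uniformizer. -/
theorem unifNorm_eq [IsDiscreteValuationRing (𝔬 K)] {ϖ : 𝔬 K} (h : Irreducible ϖ) :
    unifNorm K = ‖(ϖ : K)‖ :=
  IsGreatest.csSup_eq ⟨⟨ϖ, norm_lt_one_of_irreducible h, rfl⟩, by
    rintro _ ⟨x, hx, rfl⟩
    exact norm_le_norm_of_irreducible h hx⟩

theorem unifNorm_pos_and_lt_one (K : Type*) [NormedField K] [IsUltrametricDist K]
    [IsDiscreteValuationRing (𝔬 K)] : 0 < unifNorm K ∧ unifNorm K < 1 := by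
  obtain ⟨ϖ, h⟩ := IsDiscreteValuationRing.exists_irreducible (𝔬 K)
  rw [unifNorm_eq h]
  refine ⟨norm_pos_iff.2 ?_, norm_lt_one_of_irreducible h⟩
  simpa using h.ne_zero

/-- Every nonzero element of `K` is a product of a power of the uniformizer and a unit. -/
theorem exists_zpow_mul_of_irreducible [IsDiscreteValuationRing (𝔬 K)] {ϖ : 𝔬 K}
    (h : Irreducible ϖ) {e : K} (he : e ≠ 0) :
    ∃ (n : ℤ) (u : K), ‖u‖ = 1 ∧ e = (ϖ : K) ^ n * u := by
  have key : ∀ e : K, e ≠ 0 → ‖e‖ ≤ 1 → ∃ (n : ℤ) (u : K), ‖u‖ = 1 ∧ e = (ϖ : K) ^ n * u := by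
    intro e he h1
    have h0 : (⟨e, mem_integers.2 h1⟩ : 𝔬 K) ≠ 0 := fun hh => he (congrArg Subtype.val hh)
    obtain ⟨n, u, hu⟩ := IsDiscreteValuationRing.eq_unit_mul_pow_irreducible h0 h
    refine ⟨n, (u : 𝔬 K), isUnit_integers_iff.1 u.isUnit, ?_⟩
    rw [zpow_natCast, mul_comm]
    exact congrArg Subtype.val hu
  rcases le_total ‖e‖ 1 with h1 | h1
  · exact key e he h1
  · obtain ⟨n, u, hu, hn⟩ := key e⁻¹ (inv_ne_zero he) (by
      rw [norm_inv]; exact inv_le_one_of_one_le₀ h1)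
    refine ⟨-n, u⁻¹, by rw [norm_inv, hu, inv_one], ?_⟩
    rw [← inv_inv e, hn, mul_inv, zpow_neg]

end Valuation

section Val

variable {Fo K : Type*} [NormedField Fo] [NormedField K]

theorem val_mul {x y : K} (hx : x ≠ 0) (hy : y ≠ 0) : val Fo (x * y) = val Fo x + val Fo y := by
  rw [val, norm_mul, Real.logb_mul (norm_ne_zero_iff.2 hx) (norm_ne_zero_iff.2 hy)]; rfl

theorem val_zpow (x : K) (n : ℤ) : val Fo (x ^ n) = n * val Fo x := by
  rw [val, norm_zpow, Real.logb, Real.log_zpow, mul_div_assoc]; rfl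

theorem val_inv (x : K) : val Fo x⁻¹ = -val Fo x := by
  rw [val, norm_inv, Real.logb_inv]; rfl

theorem val_of_norm_eq_one {x : K} (hx : ‖x‖ = 1) : val Fo x = 0 := by
  rw [val, hx, Real.logb_one]

theorem val_algebraMap {L : Type*} [NormedField L] [NormedAlgebra K L] (x : K) :
    val Fo (algebraMap K L x) = val Fo x := by
  rw [val, norm_algebraMap']; rfl

variable [IsUltrametricDist Fo] [IsDiscreteValuationRing (𝔬 Fo)]

theorem logb_unifNorm_le_val {x : K} (hx : x ≠ 0) {C : ℝ} (h : ‖x‖ ≤ C) :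
    Real.logb (unifNorm Fo) C ≤ val Fo x := by
  obtain ⟨h0, h1⟩ := unifNorm_pos_and_lt_one Fo
  have hx := norm_pos_iff.2 hx
  exact (Real.logb_le_logb_of_base_lt_one h0 h1 (hx.trans_le h) hx).2 h

theorem val_le_val {x y : K} (hx : x ≠ 0) (h : ‖x‖ ≤ ‖y‖) : val Fo y ≤ val Fo x :=
  logb_unifNorm_le_val hx h

theorem val_pos {x : K} (hx : x ≠ 0) (h : ‖x‖ < 1) : 0 < val Fo x := by
  obtain ⟨h0, h1⟩ := unifNorm_pos_and_lt_one Fo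
  exact Real.logb_pos_of_base_lt_one h0 h1 (norm_pos_iff.2 hx) h

end Val

/-! ### Boundedness of lattices -/

/-- Additive maps that are bounded on the orbit `𝔬_K v` of every vector `v` are bounded on finitely
generated `𝔬_K`-submodules. -/
theorem exists_norm_le_of_fg {K : Type*} [NormedField K] [IsUltrametricDist K] {V : Type*}
    [AddCommGroup V] [Module K V] {W : Type*} [SeminormedAddCommGroup W] [IsUltrametricDist W]
    (f : V →+ W) (hf : ∀ v, ∃ C, ∀ e : K, ‖e‖ ≤ 1 → ‖f (e • v)‖ ≤ C) {L : Submodule (𝔬 K) V}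
    (hL : L.FG) : ∃ C, ∀ v ∈ L, ‖f v‖ ≤ C := by
  classical
  obtain ⟨S, rfl⟩ := hL
  induction S using Finset.induction_on with
  | empty => exact ⟨0, by simp⟩
  | insert a S _ ih =>
    obtain ⟨C, hC⟩ := ih
    obtain ⟨D, hD⟩ := hf a
    refine ⟨max D C, fun v hv => ?_⟩
    rw [Finset.coe_insert, Submodule.mem_span_insert] at hv
    obtain ⟨e, z, hz, rfl⟩ := hv
    rw [map_add]
    exact (IsUltrametricDist.norm_add_le_max _ _).trans
      (max_le_max (hD e (mem_integers.1 e.2)) (hC z hz))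

/-! ### The order function of a lattice function -/

namespace LatticeFunction

variable {Fo : Type*} [NormedField Fo] {K : Type*} [NormedField K]
    [IsUltrametricDist K] {V : Type*} [AddCommGroup V] [Module K V] (Λ : LatticeFunction Fo K V)

theorem ext_sets {Λ Λ' : LatticeFunction Fo K V} (h : ∀ r, Λ.sets r = Λ'.sets r) : Λ = Λ' := by
  have : Λ.toFun = Λ'.toFun := funext fun r => SetLike.coe_injective (h r)
  cases Λ; cases Λ'; cases this; rfl

theorem smul_mem_of_norm_le_one {e : K} (he : ‖e‖ ≤ 1) {v : V} {r : ℝ} (hv : v ∈ Λ.toFun r) :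
    e • v ∈ Λ.toFun r :=
  (Λ.toFun r).smul_mem ⟨e, mem_integers.2 he⟩ hv

variable [IsDiscreteValuationRing (𝔬 K)]

/-- `Λ(r + v(e)) = e Λ(r)` for all `e ≠ 0`, and not only for uniformizers. -/
theorem smul_mem_iff {e : K} (he : e ≠ 0) (v : V) (r : ℝ) :
    e • v ∈ Λ.toFun (r + val Fo e) ↔ v ∈ Λ.toFun r := by
  obtain ⟨ϖ, hϖ⟩ := IsDiscreteValuationRing.exists_irreducible (𝔬 K)
  have hϖ0 : (ϖ : K) ≠ 0 := by simpa using hϖ.ne_zero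
  have key : ∀ (v : V) (r : ℝ), (ϖ : K) • v ∈ Λ.toFun (r + val Fo (ϖ : K)) ↔ v ∈ Λ.toFun r := by
    intro v r
    rw [Λ.shift ϖ hϖ, hϖ.maximalIdeal_eq, Submodule.ideal_span_singleton_smul,
      Submodule.mem_smul_pointwise_iff_exists]
    constructor
    · rintro ⟨w, hw, hwv⟩
      have : (ϖ : K) • w = (ϖ : K) • v := hwv
      rwa [← smul_right_injective V hϖ0 this]
    · exact fun hv => ⟨v, hv, rfl⟩
  have keyn : ∀ (n : ℕ) (v : V) (r : ℝ),
      (ϖ : K) ^ n • v ∈ Λ.toFun (r + n * val Fo (ϖ : K)) ↔ v ∈ Λ.toFun r := by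
    intro n
    induction n with
    | zero => simp
    | succ n ih =>
      intro v r
      rw [← key v, ← ih ((ϖ : K) • v), pow_succ, mul_smul, Nat.cast_succ, add_one_mul, add_assoc,
        add_comm (val Fo (ϖ : K))]
  have keyz : ∀ (n : ℤ) (v : V) (r : ℝ),
      (ϖ : K) ^ n • v ∈ Λ.toFun (r + n * val Fo (ϖ : K)) ↔ v ∈ Λ.toFun r := by
    intro n v r
    obtain ⟨m, rfl | rfl⟩ := n.eq_nat_or_neg
    · simpa using keyn m v r
    · rw [← keyn m, ← mul_smul, zpow_neg, zpow_natCast, mul_inv_cancel₀ (pow_ne_zero _ hϖ0),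
        one_smul]
      congr! 2
      push_cast; ring
  obtain ⟨n, u, hu, rfl⟩ := exists_zpow_mul_of_irreducible hϖ he
  have hu0 : u ≠ 0 := fun h => by simp [h] at hu
  rw [val_mul (zpow_ne_zero _ hϖ0) hu0, val_of_norm_eq_one hu, add_zero, val_zpow, mul_smul, keyz]
  refine ⟨fun h => ?_, Λ.smul_mem_of_norm_le_one hu.le⟩
  have := Λ.smul_mem_of_norm_le_one (e := u⁻¹) (by rw [norm_inv, hu, inv_one]) h
  rwa [inv_smul_smul₀ hu0] at this

theorem exists_mem (v : V) : ∃ s, v ∈ Λ.toFun s := by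
  have hv : v ∈ Submodule.span K (Λ.toFun 0 : Set V) := by
    rw [(Λ.isLattice 0).span_eq_top]; trivial
  induction hv using Submodule.span_induction with
  | mem x hx => exact ⟨0, hx⟩
  | zero => exact ⟨0, zero_mem _⟩
  | add x y _ _ hx hy =>
    obtain ⟨s, hs⟩ := hx
    obtain ⟨t, ht⟩ := hy
    exact ⟨min s t, add_mem (Λ.antitone (min_le_left _ _) hs) (Λ.antitone (min_le_right _ _) ht)⟩
  | smul a x _ hx =>
    obtain ⟨s, hs⟩ := hx
    rcases eq_or_ne a 0 with rfl | ha
    · exact ⟨0, by simp⟩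
    · exact ⟨_, (Λ.smul_mem_iff ha x s).2 hs⟩

theorem exists_notMem {v : V} (hv : v ≠ 0) : ∃ s, v ∉ Λ.toFun s := by
  by_contra! hall
  obtain ⟨ϖ, hϖ⟩ := IsDiscreteValuationRing.exists_irreducible (𝔬 K)
  have hϖ0 : (ϖ : K) ≠ 0 := by simpa using hϖ.ne_zero
  have hϖ1 := norm_lt_one_of_irreducible hϖ
  obtain ⟨f, hf⟩ : ∃ f : Module.Dual K V, f v ≠ 0 := by
    by_contra! h
    exact hv ((Module.forall_dual_apply_eq_zero_iff K v).1 h)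
  obtain ⟨C, hC⟩ := exists_norm_le_of_fg (K := K) f.toAddMonoidHom
    (fun w => ⟨‖f w‖, fun e he => by
      simpa using mul_le_of_le_one_left (norm_nonneg (f w)) he⟩) (Λ.isLattice 0).fg
  obtain ⟨n, hn⟩ := pow_unbounded_of_one_lt (C / ‖f v‖)
    ((one_lt_inv₀ (norm_pos_iff.2 hϖ0)).2 hϖ1)
  have hmem : ((ϖ : K)⁻¹ ^ n) • v ∈ Λ.toFun 0 := by
    have := (Λ.smul_mem_iff (pow_ne_zero n (inv_ne_zero hϖ0)) v
      (-val Fo ((ϖ : K)⁻¹ ^ n))).2 (hall _)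
    rwa [neg_add_cancel] at this
  have := hC _ hmem
  rw [LinearMap.toAddMonoidHom_coe, map_smul, norm_smul, norm_pow, norm_inv] at this
  rw [div_lt_iff₀ (norm_pos_iff.2 hf)] at hn
  exact this.not_gt hn

/-- The norm (in additive notation) attached to a lattice function: the largest `s` such that
`v ∈ Λ(s)`, for a vector `v ≠ 0`. -/
def order (v : V) : ℝ := sSup {s | v ∈ Λ.toFun s}

theorem mem_iff_le_order {v : V} (hv : v ≠ 0) (s : ℝ) : v ∈ Λ.toFun s ↔ s ≤ Λ.order v := by
  have hne : {s | v ∈ Λ.toFun s}.Nonempty := Λ.exists_mem v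
  have hbdd : BddAbove {s | v ∈ Λ.toFun s} := by
    obtain ⟨t, ht⟩ := Λ.exists_notMem hv
    exact ⟨t, fun s hs => le_of_not_ge fun hts => ht (Λ.antitone hts hs)⟩
  have hsup : v ∈ Λ.toFun (Λ.order v) := by
    obtain ⟨s, hs, hconst⟩ := Λ.leftContinuous (Λ.order v)
    obtain ⟨t, ht, hst⟩ := exists_lt_of_lt_csSup hne hs
    have ht' : v ∈ Λ.toFun t := ht
    rwa [hconst t hst (le_csSup hbdd ht)] at ht'
  exact ⟨fun h => le_csSup hbdd h, fun h => Λ.antitone h hsup⟩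

end LatticeFunction

/-! ### Traces and admissible linear forms -/

section Trace

theorem norm_algEquiv_apply {Fo K : Type*} [NontriviallyNormedField Fo] [IsUltrametricDist Fo]
    [CompleteSpace Fo] [NormedField K] [NormedAlgebra Fo K] [FiniteDimensional Fo K]
    (σ : K ≃ₐ[Fo] K) (x : K) : ‖σ x‖ = ‖x‖ := by
  rw [NormedAlgebra.norm_eq_spectralNorm Fo, NormedAlgebra.norm_eq_spectralNorm Fo,
    ← spectralNorm_eq_of_equiv]

theorem norm_two_eq_one_of_normedAlgebra {k K : Type*} [NormedField k] [NormedField K]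
    [NormedAlgebra k K] (h2 : ‖(2 : k)‖ = 1) : ‖(2 : K)‖ = 1 := by
  rw [← map_ofNat (algebraMap k K) 2, norm_algebraMap', h2]

theorem algebraMap_trace_eq_add_of_finrank_eq_two {k K : Type*} [Field k] [Field K] [Algebra k K]
    [FiniteDimensional k K] [IsGalois k K] (h : Module.finrank k K = 2) {τ : K ≃ₐ[k] K}
    (hτ : τ ≠ 1) (x : K) : algebraMap k K (Algebra.trace k K x) = x + τ x := by
  classical
  have hcard : Fintype.card Gal(K/k) = 2 := by
    rw [← Nat.card_eq_fintype_card, IsGalois.card_aut_eq_finrank, h]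
  have huniv : (Finset.univ : Finset Gal(K/k)) = {1, τ} := by
    symm
    apply Finset.eq_univ_of_card
    rw [Finset.card_pair hτ.symm, hcard]
  rw [trace_eq_sum_automorphisms, huniv, Finset.sum_pair hτ.symm]
  rfl

/-- If `1 + τ` maps `e 𝔬_K` to `𝔭_K`, where `τ` is an isometric involution of `K`, then `e` lies
in `𝔭_K`; for a quadratic extension this says that the extension is at most tamely ramified. -/
theorem norm_lt_one_of_norm_add_lt_one {K : Type*} [NormedField K] [IsUltrametricDist K]
    (h2 : ‖(2 : K)‖ = 1) {τ : K →+* K} (hττ : ∀ x, τ (τ x) = x) {e : K}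
    (h : ∀ u, ‖u‖ ≤ 1 → ‖e * u + τ (e * u)‖ < 1) : ‖e‖ < 1 := by
  have h20 : (2 : K) ≠ 0 := fun h => by simp [h] at h2
  set p := (e + τ e) / 2 with hp
  set m := (e - τ e) / 2 with hm
  have hpm : e = p + m := by rw [hp, hm]; field_simp; ring
  have hτp : τ p = p := by
    rw [hp, map_div₀, map_add, hττ, map_ofNat, add_comm]
  have hτm : τ m = -m := by
    rw [hm, map_div₀, map_sub, hττ, map_ofNat]; ring
  have hp1 : ‖p‖ < 1 := by
    have := h 1 (by simp)
    rw [mul_one] at this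
    rwa [hp, norm_div, h2, div_one]
  have hm1 : ‖m‖ < 1 := by
    by_contra! hge
    have hm0 : m ≠ 0 := fun h => by simp [h] at hge; linarith
    -- `e m⁻¹ = p m⁻¹ + 1` has trace `2`, since `p m⁻¹` is skew
    have := h m⁻¹ (by rw [norm_inv]; exact inv_le_one_of_one_le₀ hge)
    have h2' : e * m⁻¹ + τ (e * m⁻¹) = 2 := by
      rw [hpm, map_mul, map_inv₀, map_add, hτp, hτm]
      field_simp
      ring
    rw [h2', h2] at this
    exact lt_irrefl _ this
  rw [hpm]
  exact (IsUltrametricDist.norm_add_le_max _ _).trans_lt (max_lt hp1 hm1)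

variable {Fo F : Type*} [NontriviallyNormedField Fo] [IsUltrametricDist Fo] [CompleteSpace Fo]
    [NormedField F] [IsUltrametricDist F] [NormedAlgebra Fo F] [FiniteDimensional Fo F]

theorem norm_trace_lt_one [IsGalois Fo F] {a : F} (ha : ‖a‖ < 1) :
    ‖Algebra.trace Fo F a‖ < 1 := by
  rw [← norm_algebraMap' F, trace_eq_sum_automorphisms]
  obtain ⟨τ, -, hτ⟩ := IsUltrametricDist.exists_norm_finsetSum_le_of_nonempty
    (t := (Finset.univ : Finset Gal(F/Fo))) ⟨1, Finset.mem_univ _⟩ (fun τ => τ a)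
  rw [norm_algEquiv_apply] at hτ
  exact hτ.trans_lt ha

theorem norm_lt_one_of_norm_trace_lt_one {Fo F : Type*} [NormedField Fo] [NormedField F]
    [IsUltrametricDist F] [NormedAlgebra Fo F] [FiniteDimensional Fo F]
    (h2 : ‖(2 : Fo)‖ = 1) [IsGalois Fo F] (hF : Module.finrank Fo F ≤ 2) {a : F}
    (h : ∀ u : F, ‖u‖ ≤ 1 → ‖Algebra.trace Fo F (a * u)‖ < 1) : ‖a‖ < 1 := by
  have hpos : 0 < Module.finrank Fo F := Module.finrank_pos
  obtain h1 | hF2 : Module.finrank Fo F = 1 ∨ Module.finrank Fo F = 2 := by omega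
  · obtain ⟨b, rfl⟩ := (Module.Free.bijective_algebraMap_of_finrank_eq_one h1).2 a
    have := h 1 (by simp)
    rw [mul_one, Algebra.trace_algebraMap, h1, one_smul] at this
    rwa [norm_algebraMap']
  · have hcard : Nat.card Gal(F/Fo) = 2 := by rw [IsGalois.card_aut_eq_finrank, hF2]
    obtain ⟨τ, hτ⟩ : ∃ τ : Gal(F/Fo), τ ≠ 1 := by
      have : Nontrivial Gal(F/Fo) := Finite.one_lt_card_iff_nontrivial.1 (by omega)
      exact exists_ne 1
    refine norm_lt_one_of_norm_add_lt_one (τ := (τ : F →+* F)) ?_ (fun x => ?_) fun u hu => ?_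
    · exact norm_two_eq_one_of_normedAlgebra h2
    · have : τ ^ 2 = 1 := by rw [← hcard, pow_card_eq_one']
      exact DFunLike.congr_fun (pow_two τ ▸ this) x
    · have := h u hu
      rw [← norm_algebraMap' F, algebraMap_trace_eq_add_of_finrank_eq_two hF2 hτ] at this
      exact this

end Trace

theorem coe_trace_fixedSubfield {k E : Type*} [Field k] [Field E] [Algebra k E]
    [FiniteDimensional k E] {σE : E ≃ₐ[k] E} (h1 : σE ≠ 1) (h2 : ∀ e, σE (σE e) = e) (e : E) :
    ((Algebra.trace (fixedSubfield σE) E e : fixedSubfield σE) : E) = e + σE e := by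
  have hrank : Module.finrank (fixedSubfield σE) E = 2 := by
    rw [IntermediateField.finrank_fixedField_eq_card, Nat.card_zpowers]
    refine orderOf_eq_prime ?_ h1
    rw [pow_two]
    ext e
    exact h2 e
  have : IsGalois (fixedSubfield σE) E := IsGalois.of_fixed_field E (Subgroup.zpowers σE)
  let τ : E ≃ₐ[fixedSubfield σE] E := AlgEquiv.ofRingEquiv (f := (σE : E ≃+* E)) fun x =>
    (IntermediateField.mem_fixedField_iff _ _).1 x.2 σE (Subgroup.mem_zpowers σE)
  have hτ : τ ≠ 1 := fun h => h1 <| by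
    ext e
    exact DFunLike.congr_fun h e
  exact algebraMap_trace_eq_add_of_finrank_eq_two hrank hτ e

/-- An admissible form `lam : E → F` satisfies `{e ∈ E | lam(e 𝔬_E) ⊆ 𝔭_F} = 𝔭_E`. -/
theorem IsAdmissibleForm.forall_norm_lt_one_iff {Fo F E : Type*} [NontriviallyNormedField Fo]
    [IsUltrametricDist Fo] [CompleteSpace Fo] (h2 : ‖(2 : Fo)‖ = 1)
    [NormedField F] [IsUltrametricDist F] [NormedAlgebra Fo F] [FiniteDimensional Fo F]
    [IsGalois Fo F] (hF : Module.finrank Fo F ≤ 2)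
    [NormedField E] [IsUltrametricDist E] [NormedAlgebra F E] [NormedAlgebra Fo E]
    [IsScalarTower Fo F E] [FiniteDimensional Fo E] {σ : F ≃ₐ[Fo] F} {σE : E ≃ₐ[Fo] E}
    (hσ1 : σE ≠ 1) (hσ2 : ∀ e, σE (σE e) = e)
    {lam : E →ₗ[F] F} (hlam : IsAdmissibleForm σ σE lam) (e : E) :
    (∀ u : E, ‖u‖ ≤ 1 → ‖lam (e * u)‖ < 1) ↔ ‖e‖ < 1 := by
  obtain ⟨-, -, lamo, -, htr, hdual⟩ := hlam
  have htrE := coe_trace_fixedSubfield hσ1 hσ2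
  constructor
  · intro h
    have h2E : ‖(2 : E)‖ = 1 := norm_two_eq_one_of_normedAlgebra h2
    refine norm_lt_one_of_norm_add_lt_one (τ := (σE : E →+* E)) h2E hσ2 fun u hu => ?_
    change ‖e * u + σE (e * u)‖ < 1
    rw [← htrE, ← hdual]
    intro w hw
    have : Algebra.trace (fixedSubfield σE) E (e * u) * w =
        Algebra.trace (fixedSubfield σE) E (e * (u * w)) := by
      rw [mul_comm, ← smul_eq_mul, ← map_smul, Algebra.smul_def, mul_comm, mul_assoc]
      rfl
    rw [this, htr]
    refine norm_trace_lt_one (h _ ?_)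
    rw [norm_mul]
    exact mul_le_one₀ hu (norm_nonneg _) hw
  · intro he u hu
    have key : ∀ e : E, ‖e‖ < 1 → ‖lam e‖ < 1 := by
      intro e he
      refine norm_lt_one_of_norm_trace_lt_one h2 hF fun u hu => ?_
      rw [mul_comm, ← smul_eq_mul, ← map_smul, ← htr]
      have hue : ‖u • e‖ < 1 := by
        rw [norm_smul]
        exact (mul_le_of_le_one_left (norm_nonneg _) hu).trans_lt he
      have := (hdual (Algebra.trace (fixedSubfield σE) E (u • e))).2 (by
        rw [htrE]
        refine (IsUltrametricDist.norm_add_le_max _ _).trans_lt (max_lt hue ?_)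
        rwa [norm_algEquiv_apply]) 1 (by simp)
      rwa [mul_one] at this
    refine key _ ?_
    rw [norm_mul]
    exact (mul_le_of_le_one_right (norm_nonneg _) hu).trans_lt he

/-! ### Restriction of scalars for lattice functions -/

theorem exists_le_norm {K : Type*} [NormedField K] [IsUltrametricDist K]
    [IsDiscreteValuationRing (𝔬 K)] (C : ℝ) : ∃ c : K, c ≠ 0 ∧ C ≤ ‖c‖ := by
  obtain ⟨ϖ, hϖ⟩ := IsDiscreteValuationRing.exists_irreducible (𝔬 K)
  have hϖ0 : (ϖ : K) ≠ 0 := by simpa using hϖ.ne_zero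
  obtain ⟨n, hn⟩ := pow_unbounded_of_one_lt C
    ((one_lt_inv₀ (norm_pos_iff.2 hϖ0)).2 (norm_lt_one_of_irreducible hϖ))
  exact ⟨(ϖ : K)⁻¹ ^ n, pow_ne_zero _ (inv_ne_zero hϖ0), by rw [norm_pow, norm_inv]; exact hn.le⟩

theorem exists_le_val {Fo K : Type*} [NormedField Fo] [IsUltrametricDist Fo]
    [IsDiscreteValuationRing (𝔬 Fo)] [NormedField K] [IsUltrametricDist K]
    [IsDiscreteValuationRing (𝔬 K)] (t : ℝ) : ∃ c : K, c ≠ 0 ∧ t ≤ val Fo c := by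
  obtain ⟨h0, h1⟩ := unifNorm_pos_and_lt_one Fo
  obtain ⟨c, hc0, hc⟩ := exists_le_norm (K := K) (unifNorm Fo ^ (-t))
  refine ⟨c⁻¹, inv_ne_zero hc0, ?_⟩
  have : ‖c⁻¹‖ ≤ unifNorm Fo ^ t := by
    rw [norm_inv]
    refine (inv_anti₀ (Real.rpow_pos_of_pos h0 _) hc).trans_eq ?_
    rw [Real.rpow_neg h0.le, inv_inv]
  have := logb_unifNorm_le_val (Fo := Fo) (inv_ne_zero hc0) this
  rwa [Real.logb_rpow h0 h1.ne] at this

/-- A bounded `𝔬_F`-submodule of a finite-dimensional space is finitely generated, being contained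
in the lattice spanned by a rescaled basis. -/
theorem fg_of_forall_exists_norm_le {F : Type*} [NormedField F] [IsUltrametricDist F]
    [IsDiscreteValuationRing (𝔬 F)] {V : Type*} [AddCommGroup V] [Module F V]
    [FiniteDimensional F V] {L : Submodule (𝔬 F) V}
    (hL : ∀ f : V →ₗ[F] F, ∃ C, ∀ v ∈ L, ‖f v‖ ≤ C) : L.FG := by
  let b := Module.finBasis F V
  choose C hC using fun i => hL (b.coord i)
  obtain ⟨c, hc0, hc⟩ := exists_le_norm (K := F) (∑ i, |C i|)
  have hle : L ≤ Submodule.span (𝔬 F) (Set.range fun i => c • b i) := by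
    intro v hv
    rw [← b.sum_repr v]
    refine sum_mem fun i _ => ?_
    have hi : ‖b.repr v i * c⁻¹‖ ≤ 1 := by
      rw [norm_mul, norm_inv, ← div_eq_mul_inv, div_le_one (norm_pos_iff.2 hc0)]
      exact (hC i v hv).trans ((le_abs_self _).trans
        ((Finset.single_le_sum (fun i _ => abs_nonneg (C i)) (Finset.mem_univ i)).trans hc))
    have heq : b.repr v i • b i =
        (⟨b.repr v i * c⁻¹, mem_integers.2 hi⟩ : 𝔬 F) • (c • b i) := by
      change _ = (b.repr v i * c⁻¹) • (c • b i)
      rw [← mul_smul, inv_mul_cancel_right₀ hc0]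
    rw [heq]
    exact Submodule.smul_mem _ _ (Submodule.subset_span ⟨i, rfl⟩)
  have : IsNoetherian (𝔬 F) (Submodule.span (𝔬 F) (Set.range fun i => c • b i)) :=
    isNoetherian_span_of_finite _ (Set.finite_range _)
  have hfg := (isNoetherian_submodule.1 this) L hle
  exact hfg

section RestrictScalars

variable {Fo : Type*} [NontriviallyNormedField Fo] [CompleteSpace Fo] [IsUltrametricDist Fo]
    [IsDiscreteValuationRing (𝔬 Fo)] {F : Type*} [NormedField F] [IsUltrametricDist F]
    [IsDiscreteValuationRing (𝔬 F)] [NormedAlgebra Fo F]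
    {E : Type*} [NormedField E] [IsUltrametricDist E] [IsDiscreteValuationRing (𝔬 E)]
    [NormedAlgebra F E] [NormedAlgebra Fo E] [IsScalarTower Fo F E] [FiniteDimensional Fo E]
    {V : Type*} [AddCommGroup V] [Module F V] [FiniteDimensional F V] [Module E V]
    [IsScalarTower F E V]

variable (F) in
/-- An `𝔬_E`-lattice function in `V`, regarded as an `𝔬_F`-lattice function for a subfield `F` of
`E`. The normalization of the valuations by `Fo` makes a shift of the parameter unnecessary. -/
def LatticeFunction.restrictScalars (Λ : LatticeFunction Fo E V) : LatticeFunction Fo F V where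
  toFun r :=
    { carrier := Λ.toFun r
      add_mem' := add_mem
      zero_mem' := zero_mem _
      smul_mem' := fun c v hv => by
        change (c : F) • v ∈ Λ.toFun r
        rw [← algebraMap_smul E (c : F) v]
        refine Λ.smul_mem_of_norm_le_one ?_ hv
        rw [norm_algebraMap']
        exact mem_integers.1 c.2 }
  isLattice r :=
    { fg := by
        refine fg_of_forall_exists_norm_le fun f => ?_
        refine exists_norm_le_of_fg (K := E) f.toAddMonoidHom (fun v => ?_) (Λ.isLattice r).fg
        -- `e ↦ f(e v)` is an `Fo`-linear map `E → F`, hence bounded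
        let g : E →L[Fo] F := LinearMap.toContinuousLinearMap
          ((f.comp ((LinearMap.toSpanSingleton E V v).restrictScalars F)).restrictScalars Fo)
        exact ⟨‖g‖, fun e he => (g.le_opNorm e).trans (mul_le_of_le_one_right (norm_nonneg _) he)⟩
      span_eq_top := by
        rw [eq_top_iff]
        rintro v -
        obtain ⟨s, hs⟩ := Λ.exists_mem v
        obtain ⟨c, hc0, hc⟩ := exists_le_val (Fo := Fo) (K := F) (r - s)
        have hc' : algebraMap F E c ≠ 0 := by simpa using hc0
        rw [← Submodule.smul_mem_iff _ hc0]
        refine Submodule.subset_span ?_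
        change c • v ∈ Λ.toFun r
        rw [← algebraMap_smul E c v]
        refine Λ.antitone ?_ ((Λ.smul_mem_iff hc' v s).2 hs)
        rw [val_algebraMap]
        linarith }
  antitone r s hrs := fun v hv => Λ.antitone hrs hv
  shift ϖ hϖ r := by
    have hϖ0 : (ϖ : F) ≠ 0 := by simpa using hϖ.ne_zero
    have hϖE : algebraMap F E ϖ ≠ 0 := by simpa using hϖ0
    rw [hϖ.maximalIdeal_eq, Submodule.ideal_span_singleton_smul]
    ext v
    rw [Submodule.mem_smul_pointwise_iff_exists]
    change v ∈ Λ.toFun (r + val Fo (ϖ : F)) ↔ ∃ w ∈ Λ.toFun r, (ϖ : F) • w = v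
    constructor
    · intro hv
      refine ⟨(ϖ : F)⁻¹ • v, ?_, smul_inv_smul₀ hϖ0 v⟩
      rw [← Λ.smul_mem_iff hϖE, algebraMap_smul, smul_inv_smul₀ hϖ0, val_algebraMap]
      exact hv
    · rintro ⟨w, hw, rfl⟩
      rw [← algebraMap_smul E (ϖ : F) w, ← val_algebraMap (L := E)]
      exact (Λ.smul_mem_iff hϖE w r).2 hw
  leftContinuous r := by
    obtain ⟨s, hs, h⟩ := Λ.leftContinuous r
    refine ⟨s, hs, fun t hst htr => ?_⟩
    ext v
    change v ∈ Λ.toFun t ↔ v ∈ Λ.toFun r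
    rw [h t hst htr]

/-- Self-duality is inherited by `h = lam ∘ hE` if `{e ∈ E | lam(e 𝔬_E) ⊆ 𝔭_F} = 𝔭_E`. -/
theorem LatticeFunction.IsSelfDual.restrictScalars {Λ : LatticeFunction Fo E V}
    {τ : F →+* F} {h : V →ₛₗ[τ] V →ₗ[F] F} {τE : E →+* E} {hE : V →ₛₗ[τE] V →ₗ[E] E}
    {lam : E →ₗ[F] F} (hlam : ∀ e, (∀ u : E, ‖u‖ ≤ 1 → ‖lam (e * u)‖ < 1) ↔ ‖e‖ < 1)
    (hhE : ∀ x y, h x y = lam (hE x y)) (hΛ : Λ.IsSelfDual hE) :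
    (Λ.restrictScalars F).IsSelfDual h := by
  intro r
  refine (hΛ r).trans ?_
  ext x
  constructor
  · intro hx y hy
    rw [hhE]
    simpa using (hlam _).2 (hx y hy) 1 (by simp)
  · intro hx y hy
    refine (hlam _).1 fun u hu => ?_
    have huy : u • y ∈ Λ.plus (-r) := by
      simp only [LatticeFunction.plus, Set.mem_iUnion] at hy ⊢
      obtain ⟨s, hs, hy⟩ := hy
      exact ⟨s, hs, Λ.smul_mem_of_norm_le_one hu hy⟩
    have := hx _ huy
    rwa [hhE, map_smul, smul_eq_mul, mul_comm] at this

end RestrictScalars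

/-! ### The adjoint involution and the filtration of the centralizer -/

section Adjoint

variable {Fo : Type*} [NormedField Fo] {F : Type*} [NormedField F] [IsUltrametricDist F]
    {V : Type*} [AddCommGroup V] [Module F V] {τ : F →+* F} {h : V →ₛₗ[τ] V →ₗ[F] F}

/-- The filtration of `End_F(V)` attached to a self-dual lattice function is stable under the
adjoint involution. -/
theorem mem_endFiltration_of_adjoint {Λ : LatticeFunction Fo F V} (hΛ : Λ.IsSelfDual h)
    {a a' : Module.End F V} (hadj : ∀ x y, h (a' x) y = h x (a y)) {r : ℝ}
    (ha : a ∈ endFiltration Λ.sets r) : a' ∈ endFiltration Λ.sets r := by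
  intro s x hx
  rw [hΛ] at hx ⊢
  intro y hy
  rw [hadj]
  refine hx _ ?_
  simp only [LatticeFunction.plus, Set.mem_iUnion] at hy ⊢
  obtain ⟨t, ht, hy⟩ := hy
  refine ⟨t + r, ?_, ha t y hy⟩
  have ht : -(s + r) < t := ht
  change -s < t + r
  linarith

/-- Since `β` is skew and commutes with `a`, the elements `a - a^σ` and `β (a + a^σ)` lie in the
centralizer `𝔥` of `β`, and they determine `a` as `2` is a unit. In this way the filtration of `𝔥`
controls that of the whole centralizer of `β` in `End_F(V)`. -/
theorem mem_endFiltration_of_forall_lieCentralizer {X Y : LatticeFunction Fo F V}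
    (h2 : ‖(2 : F)‖ = 1) (hX : X.IsSelfDual h) {β : Module.End F V} (hβ : β ∈ lieAlg h) {t : ℝ}
    (hXβ : ∀ s, ∀ v ∈ X.toFun s, β v ∈ X.toFun (s + t))
    (hYβ : ∀ s v, β v ∈ Y.toFun (s + t) → v ∈ Y.toFun s)
    (hXY : ∀ r, ∀ a ∈ lieCentralizer h β,
      a ∈ endFiltration X.sets r → a ∈ endFiltration Y.sets r)
    {a a' : Module.End F V} (hadj : ∀ x y, h (a x) y = h x (a' y))
    (hadj' : ∀ x y, h (a' x) y = h x (a y)) (haβ : a * β = β * a) (haβ' : a' * β = β * a')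
    {r : ℝ} (ha : a ∈ endFiltration X.sets r) : a ∈ endFiltration Y.sets r := by
  have ha' : a' ∈ endFiltration X.sets r := mem_endFiltration_of_adjoint hX hadj' ha
  have hskew : ∀ x y, h (β x) y = -h x (β y) := fun x y => eq_neg_of_add_eq_zero_left (hβ x y)
  have hcomm : ∀ x, a (β x) = β (a x) := fun x => LinearMap.congr_fun haβ x
  have hcomm' : ∀ x, a' (β x) = β (a' x) := fun x => LinearMap.congr_fun haβ' x
  have hd : a - a' ∈ endFiltration Y.sets r := by
    refine hXY r _ ⟨fun x y => ?_, by rw [sub_mul, mul_sub, haβ, haβ']⟩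
      fun s x hx => (X.toFun (s + r)).sub_mem (ha s x hx) (ha' s x hx)
    simp only [LinearMap.sub_apply, map_sub, hadj, hadj']
    ring
  have hp : β * (a + a') ∈ endFiltration Y.sets (r + t) := by
    refine hXY _ _ ⟨fun x y => ?_, by rw [mul_assoc, add_mul, haβ, haβ', ← mul_add]⟩
      fun s x hx => ?_
    · simp only [Module.End.mul_apply, LinearMap.add_apply, hskew, map_add, hadj, hadj', hcomm,
        hcomm']
      ring
    · rw [← add_assoc]
      exact hXβ _ _ ((X.toFun (s + r)).add_mem (ha s x hx) (ha' s x hx))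
  intro s x hx
  have h1 : a x - a' x ∈ Y.toFun (s + r) := hd s x hx
  have h3 : β (a x + a' x) ∈ Y.toFun (s + r + t) := by
    rw [add_assoc]
    exact hp s x hx
  have h4 := add_mem h1 (hYβ _ _ h3)
  have h20 : (2 : F) ≠ 0 := fun h => by simp [h] at h2
  have h5 := Y.smul_mem_of_norm_le_one (e := (2 : F)⁻¹) (by rw [norm_inv, h2, inv_one]) h4
  have h6 : (2 : F)⁻¹ • (a x - a' x + (a x + a' x)) = a x := by
    rw [show a x - a' x + (a x + a' x) = (2 : F) • a x by rw [two_smul]; abel,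
      inv_smul_smul₀ h20]
  rwa [h6] at h5

end Adjoint

/-! ### Lattice functions up to translation -/

section Translation

variable {Fo : Type*} [NormedField Fo] {F : Type*} [NormedField F] [IsUltrametricDist F]
    [IsDiscreteValuationRing (𝔬 F)] {V : Type*} [AddCommGroup V] [Module F V]

/-- A self-dual lattice function is determined by its translation class. -/
theorem LatticeFunction.IsSelfDual.eq_of_order_eq_add {X Y : LatticeFunction Fo F V}
    {τ : F →+* F} {h : V →ₛₗ[τ] V →ₗ[F] F} (hX : X.IsSelfDual h) (hY : Y.IsSelfDual h) {t : ℝ}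
    (ht : ∀ v, v ≠ 0 → X.order v = Y.order v + t) : X = Y := by
  have h1 : ∀ s, X.sets s = Y.sets (s - t) := by
    intro s
    ext v
    change v ∈ X.toFun s ↔ v ∈ Y.toFun (s - t)
    rcases eq_or_ne v 0 with rfl | hv
    · simp
    · rw [X.mem_iff_le_order hv, Y.mem_iff_le_order hv, ht v hv, sub_le_iff_le_add]
  -- duality turns the translation by `t` into the translation by `-t`
  have h2 : ∀ s, X.sets s = Y.sets (s + t) := by
    intro s
    rw [hX, hY]
    congr 1
    ext v
    simp only [LatticeFunction.plus, Set.mem_iUnion, h1]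
    constructor
    · rintro ⟨p, hp, hv⟩
      have hp : -s < p := hp
      exact ⟨p - t, by change -(s + t) < p - t; linarith, hv⟩
    · rintro ⟨p, hp, hv⟩
      have hp : -(s + t) < p := hp
      exact ⟨p + t, by change -s < p + t; linarith, by rwa [add_sub_cancel_right]⟩
  refine LatticeFunction.ext_sets fun s => ?_
  ext v
  change v ∈ X.toFun s ↔ v ∈ Y.toFun s
  rcases eq_or_ne v 0 with rfl | hv
  · simp
  · have hmem : v ∈ Y.sets (Y.order v) := (Y.mem_iff_le_order hv _).2 le_rfl
    have hle : Y.order v + t + t ≤ Y.order v := by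
      refine (Y.mem_iff_le_order hv _).1 ?_
      change v ∈ Y.sets _
      rwa [← h2, h1, add_sub_cancel_right]
    have hge : Y.order v - t - t ≤ Y.order v := by
      refine (Y.mem_iff_le_order hv _).1 ?_
      change v ∈ Y.sets _
      rwa [← h1, h2, sub_add_cancel]
    have ht0 : t = 0 := by linarith
    rw [X.mem_iff_le_order hv, Y.mem_iff_le_order hv, ht v hv, ht0, add_zero]

variable {E : Type*} [NormedField E] [Module E V]

theorem LatticeFunction.order_smul {X : LatticeFunction Fo F V}
    (hX : ∀ e : E, e ≠ 0 → ∀ s, ∀ v ∈ X.toFun s, e • v ∈ X.toFun (s + val Fo e))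
    {e : E} (he : e ≠ 0) {v : V} (hv : v ≠ 0) : X.order (e • v) = X.order v + val Fo e := by
  have hev : e • v ≠ 0 := smul_ne_zero he hv
  apply le_antisymm
  · have := hX e⁻¹ (inv_ne_zero he) _ _ ((X.mem_iff_le_order hev _).2 le_rfl)
    rw [inv_smul_smul₀ he, X.mem_iff_le_order hv, val_inv] at this
    linarith
  · exact (X.mem_iff_le_order hev _).1 (hX e he _ _ ((X.mem_iff_le_order hv _).2 le_rfl))

theorem LatticeFunction.forall_smul_mem_iff {X : LatticeFunction Fo F V}
    (hX : ∀ e : E, e ≠ 0 → ∀ s, ∀ v ∈ X.toFun s, e • v ∈ X.toFun (s + val Fo e))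
    (g : V →ₗ[E] E) {v : V} (hv : v ≠ 0) (r : ℝ) :
    (∀ s, ∀ w ∈ X.toFun s, g w • v ∈ X.toFun (s + r)) ↔
      ∀ w, g w ≠ 0 → X.order w + r ≤ X.order v + val Fo (g w) := by
  constructor
  · intro H w hw
    have hw0 : w ≠ 0 := fun h => hw (by rw [h, map_zero])
    rw [← order_smul hX hw hv, ← X.mem_iff_le_order (smul_ne_zero hw hv)]
    exact H _ w ((X.mem_iff_le_order hw0 _).2 le_rfl)
  · intro H s w hws
    by_cases hw : g w = 0
    · rw [hw, zero_smul]
      exact zero_mem _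
    · have hw0 : w ≠ 0 := fun h => hw (by rw [h, map_zero])
      rw [X.mem_iff_le_order (smul_ne_zero hw hv), order_smul hX hw hv]
      exact (add_le_add_left ((X.mem_iff_le_order hw0 _).1 hws) r).trans (H w hw)

variable [IsUltrametricDist Fo] [IsDiscreteValuationRing (𝔬 Fo)]
    [IsUltrametricDist E] [IsDiscreteValuationRing (𝔬 E)]

/-- Rank one operators `w ↦ g(w) v` with a fixed `g` detect a lattice function up to translation:
the largest `r` for which this operator shifts `X` by `r` is the order of `v` minus a constant that
depends on `g` only. -/
theorem LatticeFunction.exists_order_eq_add {X Y : LatticeFunction Fo F V}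
    (hX : ∀ e : E, e ≠ 0 → ∀ s, ∀ v ∈ X.toFun s, e • v ∈ X.toFun (s + val Fo e))
    (hY : ∀ e : E, e ≠ 0 → ∀ s, ∀ v ∈ Y.toFun s, e • v ∈ Y.toFun (s + val Fo e))
    {g : V →ₗ[E] E} (hg : g ≠ 0) (hb : ∃ C, ∀ w ∈ X.toFun 0, ‖g w‖ ≤ C)
    (hXY : ∀ r v, (∀ s, ∀ w ∈ X.toFun s, g w • v ∈ X.toFun (s + r)) ↔
      ∀ s, ∀ w ∈ Y.toFun s, g w • v ∈ Y.toFun (s + r)) :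
    ∃ t, ∀ v, v ≠ 0 → X.order v = Y.order v + t := by
  obtain ⟨w₀, hw₀⟩ : ∃ w, g w ≠ 0 := by
    by_contra! h
    exact hg (LinearMap.ext h)
  have hw₀0 : w₀ ≠ 0 := fun h => hw₀ (by rw [h, map_zero])
  -- `S = {r | order w + r ≤ val (g w) for all w}`; the shifts allowed at `v` are `order v + S`
  set SX : Set ℝ := {r | ∀ w, g w ≠ 0 → X.order w + r ≤ val Fo (g w)} with hSX
  set SY : Set ℝ := {r | ∀ w, g w ≠ 0 → Y.order w + r ≤ val Fo (g w)} with hSY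
  have key : ∀ v, v ≠ 0 → ∀ r, r - X.order v ∈ SX ↔ r - Y.order v ∈ SY := by
    intro v hv r
    have := hXY r v
    rw [forall_smul_mem_iff hX g hv, forall_smul_mem_iff hY g hv] at this
    have aux : ∀ p q z : ℝ, p + (r - q) ≤ z ↔ p + r ≤ q + z := fun p q z => by
      constructor <;> intro <;> linarith
    simpa only [hSX, hSY, Set.mem_ofPred_eq, aux] using this
  have hbdd : BddAbove SX := ⟨val Fo (g w₀) - X.order w₀, fun r hr => by
    have := hr w₀ hw₀
    linarith⟩
  have hne : SX.Nonempty := by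
    obtain ⟨C, hC⟩ := hb
    obtain ⟨ϖ, hϖ⟩ := IsDiscreteValuationRing.exists_irreducible (𝔬 E)
    have hϖ0 : (ϖ : E) ≠ 0 := by simpa using hϖ.ne_zero
    have hpos := val_pos (Fo := Fo) hϖ0 (norm_lt_one_of_irreducible hϖ)
    refine ⟨Real.logb (unifNorm Fo) C - val Fo (ϖ : E), fun w hw => ?_⟩
    have hw0 : w ≠ 0 := fun h => hw (by rw [h, map_zero])
    -- rescale `w` by a power of the uniformizer so that its order lies in `[0, val ϖ]`
    obtain ⟨n, hn, hn'⟩ : ∃ n : ℤ, 0 ≤ X.order w + n * val Fo (ϖ : E) ∧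
        X.order w + n * val Fo (ϖ : E) ≤ val Fo (ϖ : E) := by
      refine ⟨⌈-X.order w / val Fo (ϖ : E)⌉, ?_, ?_⟩
      · have := (div_le_iff₀ hpos).1 (Int.le_ceil (-X.order w / val Fo (ϖ : E)))
        linarith
      · have h1 := (Int.ceil_lt_add_one (-X.order w / val Fo (ϖ : E))).le
        have h2 := mul_le_mul_of_nonneg_right h1 hpos.le
        rw [add_mul, div_mul_cancel₀ _ hpos.ne'] at h2
        linarith
    have hn0 : (ϖ : E) ^ n ≠ 0 := zpow_ne_zero _ hϖ0
    have hmem : (ϖ : E) ^ n • w ∈ X.toFun 0 := by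
      rw [X.mem_iff_le_order (smul_ne_zero hn0 hw0), order_smul hX hn0 hw0, val_zpow]
      exact hn
    have hle := hC _ hmem
    rw [map_smul, smul_eq_mul] at hle
    have := logb_unifNorm_le_val (Fo := Fo) (mul_ne_zero hn0 hw) hle
    rw [val_mul hn0 hw, val_zpow] at this
    linarith
  have hsup : IsLUB SX (sSup SX) := isLUB_csSup hne hbdd
  have hSYne : SY.Nonempty := by
    obtain ⟨r, hr⟩ := hne
    exact ⟨_, (key w₀ hw₀0 (r + X.order w₀)).1 (by rwa [add_sub_cancel_right])⟩
  have hSYbdd : BddAbove SY := ⟨val Fo (g w₀) - Y.order w₀, fun r hr => by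
    have := hr w₀ hw₀
    linarith⟩
  refine ⟨sSup SY - sSup SX, fun v hv => ?_⟩
  apply le_antisymm
  · have : sSup SX ≤ sSup SY + Y.order v - X.order v := by
      refine csSup_le hne fun r hr => ?_
      have := le_csSup hSYbdd ((key v hv (r + X.order v)).1 (by rwa [add_sub_cancel_right]))
      linarith
    linarith
  · have : sSup SY ≤ sSup SX + X.order v - Y.order v := by
      refine csSup_le hSYne fun r hr => ?_
      have := le_csSup hbdd ((key v hv (r + Y.order v)).2 (by rwa [add_sub_cancel_right]))
      linarith
    linarith

end Translation

/-! ### Uniqueness from the filtration of the centralizer -/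

section Centralizer

variable {Fo : Type*} [NormedField Fo] [IsUltrametricDist Fo] [IsDiscreteValuationRing (𝔬 Fo)]
    {F : Type*} [NormedField F] [IsUltrametricDist F]
    {E : Type*} [NormedField E] [IsUltrametricDist E] [NormedAlgebra F E]
    {V : Type*} [AddCommGroup V] [Module F V] [Module E V] [IsScalarTower F E V]
    {τ : F →+* F} {h : V →ₛₗ[τ] V →ₗ[F] F} {β : Module.End F V} {b : E} {σE : E →+* E}

/-- If `Y` carries the filtration of `𝔥` given by `X`, and `X` is an `𝔬_E`-lattice function, then so
is `Y`: the skew elements of `E` belong to `𝔥`, the symmetric ones are products of two skew elements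
because `E` contains the skew unit `β`, and `2` is a unit. -/
theorem smul_mem_of_forall_lieCentralizer {X Y : LatticeFunction Fo F V}
    (h2 : ‖(2 : E)‖ = 1) (hb0 : b ≠ 0) (hbβ : ∀ x, β x = b • x) (hσb : σE b = -b)
    (hσσ : ∀ e, σE (σE e) = e) (hσnorm : ∀ e, ‖σE e‖ = ‖e‖)
    (hσh : ∀ (e : E) (x y : V), h (e • x) y = h x (σE e • y))
    (hX : ∀ e : E, e ≠ 0 → ∀ s, ∀ v ∈ X.toFun s, e • v ∈ X.toFun (s + val Fo e))
    (hXY : ∀ r, ∀ a ∈ lieCentralizer h β,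
      a ∈ endFiltration X.sets r → a ∈ endFiltration Y.sets r) :
    ∀ e : E, e ≠ 0 → ∀ s, ∀ v ∈ Y.toFun s, e • v ∈ Y.toFun (s + val Fo e) := by
  have h20 : (2 : E) ≠ 0 := fun h => by simp [h] at h2
  have hskew : ∀ e : E, e ≠ 0 → σE e = -e →
      ∀ s, ∀ v ∈ Y.toFun s, e • v ∈ Y.toFun (s + val Fo e) := by
    intro e he hσe
    refine hXY (val Fo e) ((LinearMap.lsmul E V e).restrictScalars F) ⟨fun x y => ?_, ?_⟩
      fun s v hv => hX e he s v hv
    · change h (e • x) y + h x (e • y) = 0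
      rw [hσh, hσe, neg_smul, map_neg, neg_add_cancel]
    · ext x
      change e • β x = β (e • x)
      rw [hbβ, hbβ, smul_comm]
  have hsymm : ∀ e : E, e ≠ 0 → σE e = e →
      ∀ s, ∀ v ∈ Y.toFun s, e • v ∈ Y.toFun (s + val Fo e) := by
    intro e he hσe s v hv
    have h1 := hskew b⁻¹ (inv_ne_zero hb0) (by rw [map_inv₀, hσb, inv_neg]) s v hv
    have h3 := hskew (e * b) (mul_ne_zero he hb0) (by rw [map_mul, hσe, hσb, mul_neg]) _ _ h1
    rwa [← mul_smul, mul_inv_cancel_right₀ hb0, add_assoc, val_mul he hb0, val_inv,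
      neg_add_cancel_comm_assoc] at h3
  intro e he s v hv
  have hhalf : ∀ x : E, ‖x‖ ≤ ‖e‖ → ‖x / 2‖ ≤ ‖e‖ := fun x hx => by
    rwa [norm_div, h2, div_one]
  have key : ∀ x : E, ‖x‖ ≤ ‖e‖ →
      (x ≠ 0 → ∀ s, ∀ v ∈ Y.toFun s, x • v ∈ Y.toFun (s + val Fo x)) →
      x • v ∈ Y.toFun (s + val Fo e) := by
    intro x hx hmem
    rcases eq_or_ne x 0 with rfl | hx0
    · rw [zero_smul]
      exact zero_mem _
    · exact Y.antitone (add_le_add_right (val_le_val hx0 hx) s) (hmem hx0 s v hv)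
  have hsum : e = (e + σE e) / 2 + (e - σE e) / 2 := by field_simp; ring
  have hp := key ((e + σE e) / 2)
    (hhalf _ ((IsUltrametricDist.norm_add_le_max _ _).trans (by rw [hσnorm, max_self])))
    fun h0 => hsymm _ h0 (by rw [map_div₀, map_add, hσσ, map_ofNat, add_comm])
  have hm := key ((e - σE e) / 2)
    (hhalf _ (by
      rw [sub_eq_add_neg]
      exact (IsUltrametricDist.norm_add_le_max _ _).trans (by rw [norm_neg, hσnorm, max_self])))
    fun h0 => hskew _ h0 (by rw [map_div₀, map_sub, hσσ, map_ofNat]; ring)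
  have := add_mem hp hm
  rwa [← add_smul, ← hsum] at this

variable [IsDiscreteValuationRing (𝔬 F)] [IsDiscreteValuationRing (𝔬 E)]

/-- A self-dual `𝔬_E`-lattice function is determined, among all self-dual `𝔬_F`-lattice functions,
by the filtration it induces on the centralizer `𝔥` of `β`. -/
theorem eq_of_endFiltration_lieCentralizer_iff {X Y : LatticeFunction Fo F V}
    (h2 : ‖(2 : F)‖ = 1) {ε : ℤˣ} (hherm : IsEpsHermitian ((ε : ℤ) : F) h)
    (hβ : β ∈ lieAlg h) (hb0 : b ≠ 0) (hbβ : ∀ x, β x = b • x) (hσb : σE b = -b)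
    (hσσ : ∀ e, σE (σE e) = e) (hσnorm : ∀ e, ‖σE e‖ = ‖e‖)
    (hσh : ∀ (e : E) (x y : V), h (e • x) y = h x (σE e • y))
    {lam : E →ₗ[F] F} {hE : V →ₛₗ[σE] V →ₗ[E] E}
    (hEherm : IsEpsHermitian ((ε : ℤ) : E) hE) (hhE : ∀ x y, h x y = lam (hE x y))
    {u : V} (hu : hE u ≠ 0) (hbd : ∃ C, ∀ w ∈ X.toFun 0, ‖hE u w‖ ≤ C)
    (hXdual : X.IsSelfDual h) (hYdual : Y.IsSelfDual h)
    (hX : ∀ e : E, e ≠ 0 → ∀ s, ∀ v ∈ X.toFun s, e • v ∈ X.toFun (s + val Fo e))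
    (hXY : ∀ r, ∀ a ∈ lieCentralizer h β,
      a ∈ endFiltration X.sets r ↔ a ∈ endFiltration Y.sets r) : X = Y := by
  have hY := smul_mem_of_forall_lieCentralizer (norm_two_eq_one_of_normedAlgebra h2) hb0 hbβ hσb
    hσσ hσnorm hσh hX fun r a ha => (hXY r a ha).1
  have hβmem : ∀ Z : LatticeFunction Fo F V,
      (∀ e : E, e ≠ 0 → ∀ s, ∀ v ∈ Z.toFun s, e • v ∈ Z.toFun (s + val Fo e)) →
      (∀ s, ∀ v ∈ Z.toFun s, β v ∈ Z.toFun (s + val Fo b)) ∧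
      ∀ s v, β v ∈ Z.toFun (s + val Fo b) → v ∈ Z.toFun s := by
    refine fun Z hZ => ⟨fun s v hv => by rw [hbβ]; exact hZ b hb0 s v hv, fun s v hv => ?_⟩
    have := hZ b⁻¹ (inv_ne_zero hb0) _ _ hv
    rwa [hbβ, inv_smul_smul₀ hb0, val_inv, add_neg_cancel_right] at this
  -- the rank one operator `w ↦ hE(p, w) q`; its adjoint is `w ↦ ε hE(q, w) p`
  let rk (p q : V) : Module.End F V :=
    ((LinearMap.toSpanSingleton E V q).comp (hE p)).restrictScalars F
  have hrk : ∀ p q w, rk p q w = hE p w • q := fun _ _ _ => rfl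
  have hrkβ : ∀ p q, rk p q * β = β * rk p q := by
    intro p q
    ext w
    rw [Module.End.mul_apply, Module.End.mul_apply, hrk, hrk, hbβ, hbβ, map_smul, smul_assoc]
  have hε : ((ε : ℤ) : E) * ((ε : ℤ) : E) = 1 := by
    rw [← Int.cast_mul, Int.units_coe_mul_self, Int.cast_one]
  have hadj : ∀ q x y, h (rk u q x) y = h x (rk q (((ε : ℤ) : E) • u) y) := by
    intro q x y
    rw [hrk, hrk, hhE, hhE, LinearMap.map_smulₛₗ, LinearMap.smul_apply,
      (hE x).map_smul, (hE x).map_smul, hEherm u x, smul_eq_mul, smul_eq_mul, smul_eq_mul, ← mul_assoc _ _ (σE _), hε,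
      one_mul, mul_comm]
  have hadj' : ∀ q x y, h (rk q (((ε : ℤ) : E) • u) x) y = h x (rk u q y) := by
    intro q x y
    rw [hherm y, ← hadj, ← hherm]
  obtain ⟨t, ht⟩ := LatticeFunction.exists_order_eq_add hX hY hu hbd fun r q =>
    ⟨mem_endFiltration_of_forall_lieCentralizer h2 hXdual hβ (hβmem X hX).1 (hβmem Y hY).2
      (fun r a ha => (hXY r a ha).1) (hadj q) (hadj' q) (hrkβ _ _) (hrkβ _ _) (r := r),
    mem_endFiltration_of_forall_lieCentralizer h2 hYdual hβ (hβmem Y hY).1 (hβmem X hX).2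
      (fun r a ha => (hXY r a ha).2) (hadj q) (hadj' q) (hrkβ _ _) (hrkβ _ _) (r := r)⟩
  exact hXdual.eq_of_order_eq_add hYdual ht

end Centralizer

end ClassicalBuilding

end

/-! ### The embedding of the building of the centralizer -/

/-- One-block case of the uniqueness of the embedding of the building of the centralizer. -/
theorem theorem11p2
    -- the ground field `Fo`: non-archimedean, locally compact, residual characteristic not `2`
    {Fo : Type*} [NontriviallyNormedField Fo] [IsUltrametricDist Fo] [LocallyCompactSpace Fo]
    (h2 : ‖(2 : Fo)‖ = 1)
    -- `F / Fo` is Galois of degree at most `2`, with the unique extension of the absolute value,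
    -- and `σ` generates its Galois group
    {F : Type*} [NormedField F] [IsUltrametricDist F] [NormedAlgebra Fo F]
    [FiniteDimensional Fo F] [IsGalois Fo F] (hF : Module.finrank Fo F ≤ 2)
    (σ : F ≃ₐ[Fo] F) (hσ : Subgroup.zpowers σ = ⊤)
    -- the nondegenerate `ε`-hermitian space `(V, h)`
    (ε : ℤˣ)
    {V : Type*} [AddCommGroup V] [Module F V] [FiniteDimensional F V]
    (h : V →ₛₗ[(σ : F →+* F)] V →ₗ[F] F)
    (hherm : ClassicalBuilding.IsEpsHermitian ((ε : ℤ) : F) h)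
    (hnondeg : ∀ x, (∀ y, h x y = 0) → x = 0)
    -- `β` is a nonzero element of `𝔤`
    (β : Module.End F V) (hβ : β ∈ ClassicalBuilding.lieAlg h) (hβ0 : β ≠ 0)
    -- `E = F[β]` is a field, acting on `V` through its inclusion in `End_F(V)`, with the unique
    -- extension of the absolute value
    {E : Type*} [NormedField E] [IsUltrametricDist E] [NormedAlgebra F E]
    [NormedAlgebra Fo E] [IsScalarTower Fo F E]
    (φ : E ≃ₐ[F] Algebra.adjoin F {β})
    [Module E V] (hφ : ∀ (e : E) (x : V), e • x = (φ e : Module.End F V) x)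
    -- `σE` is the restriction to `E` of the adjoint involution of `End_F(V)`
    (σE : E ≃ₐ[Fo] E) (hσE : ∀ (e : E) (x y : V), h (e • x) y = h x (σE e • y))
    -- the `ε`-hermitian form `hE` over `E` with `h = lam ∘ hE`, `lam` being admissible
    (lam : E →ₗ[F] F) (hlam : ClassicalBuilding.IsAdmissibleForm σ σE lam)
    (hE : V →ₛₗ[(σE : E →+* E)] V →ₗ[E] E)
    (hEherm : ClassicalBuilding.IsEpsHermitian ((ε : ℤ) : E) hE)
    (hhE : ∀ x y, h x y = lam (hE x y)) :
    -- there is a map `jβ` between the buildings, `jβ(Λ)` being `Λ` seen as an `𝔬_F`-lattice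
    -- function, such that
    ∃ jβ : ClassicalBuilding.Building Fo hE → ClassicalBuilding.Building Fo h,
      (∀ x r, (jβ x).1.sets r = x.1.sets r) ∧
      -- `y = jβ(x)` as soon as the filtrations at `x` and `y` are compatible, and
      (∀ (x : ClassicalBuilding.Building Fo hE) (y : ClassicalBuilding.Building Fo h),
        (∀ r, ClassicalBuilding.gFiltration y r ∩ ClassicalBuilding.lieCentralizer h β =
          ClassicalBuilding.hFiltration h β x r) → y = jβ x) ∧
      -- `jβ` is the unique map compatible with the Lie algebra filtrations
      (∀ j : ClassicalBuilding.Building Fo hE → ClassicalBuilding.Building Fo h,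
        (∀ x r, ClassicalBuilding.gFiltration (j x) r ∩ ClassicalBuilding.lieCentralizer h β =
          ClassicalBuilding.hFiltration h β x r) ↔ j = jβ) := by
  have : ProperSpace Fo := .of_nontriviallyNormedField_of_weaklyLocallyCompactSpace Fo
  have hfinE : FiniteDimensional F E := Module.Finite.equiv φ.symm.toLinearEquiv
  have hfinE' : FiniteDimensional Fo E := Module.Finite.trans F E
  have : ProperSpace F := FiniteDimensional.proper Fo F
  have : ProperSpace E := FiniteDimensional.proper Fo E
  obtain ⟨c, hc0, hc1⟩ := NormedField.exists_norm_lt_one Fo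
  have hdvrFo : IsDiscreteValuationRing (ClassicalBuilding.𝔬 Fo) :=
    ClassicalBuilding.isDiscreteValuationRing_integers ⟨c, norm_pos_iff.1 hc0, hc1⟩
  have hdvrF : IsDiscreteValuationRing (ClassicalBuilding.𝔬 F) :=
    ClassicalBuilding.isDiscreteValuationRing_integers ⟨algebraMap Fo F c,
      by simpa using norm_pos_iff.1 hc0, by rwa [norm_algebraMap']⟩
  have hdvrE : IsDiscreteValuationRing (ClassicalBuilding.𝔬 E) :=
    ClassicalBuilding.isDiscreteValuationRing_integers ⟨algebraMap Fo E c,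
      by simpa using norm_pos_iff.1 hc0, by rwa [norm_algebraMap']⟩
  have htower : IsScalarTower F E V := .of_algebraMap_smul fun a x => by
    rw [hφ, AlgEquiv.commutes]
    rfl
  have hnondeg' : ∀ z, (∀ x, h x z = 0) → z = 0 := fun z hz => hnondeg z fun x => by
    rw [hherm x z, hz, map_zero, mul_zero]
  obtain ⟨u, hu0⟩ : ∃ u : V, u ≠ 0 := by
    by_contra! hV
    exact hβ0 (LinearMap.ext fun x => by rw [hV (β x), LinearMap.zero_apply])
  have hfaith : ∀ e e' : E, (∀ x : V, e • x = e' • x) → e = e' := fun e e' hee =>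
    smul_left_injective E hu0 (hee u)
  set b : E := φ.symm ⟨β, Algebra.self_mem_adjoin_singleton F β⟩ with hb
  have hbβ : ∀ x, β x = b • x := fun x => by rw [hφ, hb, AlgEquiv.apply_symm_apply]
  have hb0 : b ≠ 0 := fun hb0 => hβ0 (LinearMap.ext fun x => by
    rw [hbβ, hb0, zero_smul, LinearMap.zero_apply])
  have hσb : σE b = -b := hfaith _ _ fun x => by
    rw [← sub_eq_zero]
    refine hnondeg' _ fun y => ?_
    have := hβ y x
    rw [hbβ, hbβ, hσE] at this
    rw [neg_smul, sub_neg_eq_add, map_add, this]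
  have hσσ : ∀ e, σE (σE e) = e := fun e => hfaith _ _ fun x => by
    rw [← sub_eq_zero]
    refine hnondeg' _ fun y => ?_
    rw [map_sub, ← hσE, hherm x, ← hσE, ← hherm, sub_self]
  have h2F : ‖(2 : F)‖ = 1 := ClassicalBuilding.norm_two_eq_one_of_normedAlgebra h2
  have h2E : ‖(2 : E)‖ = 1 := ClassicalBuilding.norm_two_eq_one_of_normedAlgebra h2
  have hσ1 : σE ≠ 1 := fun h1 => by
    rw [h1, AlgEquiv.one_apply, eq_neg_iff_add_eq_zero, ← two_mul] at hσb
    rcases mul_eq_zero.1 hσb with h | h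
    · simp [h] at h2E
    · exact hb0 h
  have hdual := hlam.forall_norm_lt_one_iff h2 hF hσ1 hσσ
  have hEu : hE u ≠ 0 := fun h0 => hu0 <| hnondeg u fun y => by
    rw [hhE, h0, LinearMap.zero_apply, map_zero]
  let jβ : ClassicalBuilding.Building Fo hE → ClassicalBuilding.Building Fo h := fun x =>
    ⟨x.1.restrictScalars F, x.2.restrictScalars hdual hhE⟩
  have hcompat : ∀ x r, ClassicalBuilding.gFiltration (jβ x) r ∩
      ClassicalBuilding.lieCentralizer h β = ClassicalBuilding.hFiltration h β x r := by
    intro x r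
    ext a
    exact ⟨fun ha => ⟨ha.2, ha.1.2⟩, fun ha => ⟨⟨ha.1.1, ha.2⟩, ha.1⟩⟩
  have huniq : ∀ (x : ClassicalBuilding.Building Fo hE) (y : ClassicalBuilding.Building Fo h),
      (∀ r, ClassicalBuilding.gFiltration y r ∩ ClassicalBuilding.lieCentralizer h β =
        ClassicalBuilding.hFiltration h β x r) → y = jβ x := by
    intro x y hxy
    refine Subtype.ext (Eq.symm ?_)
    have hbd : ∃ C, ∀ w ∈ (jβ x).1.toFun 0, ‖hE u w‖ ≤ C :=
      ClassicalBuilding.exists_norm_le_of_fg (K := E) (hE u).toAddMonoidHom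
        (fun w => ⟨‖hE u w‖, fun e he => by
          simpa using mul_le_of_le_one_left (norm_nonneg (hE u w)) he⟩) (x.1.isLattice 0).fg
    refine ClassicalBuilding.eq_of_endFiltration_lieCentralizer_iff h2F hherm hβ hb0 hbβ hσb hσσ
      (fun e => ClassicalBuilding.norm_algEquiv_apply σE e) hσE hEherm hhE hEu hbd (jβ x).2 y.2
      (fun e he s v hv => (x.1.smul_mem_iff he v s).2 hv) fun r a ha => ?_
    have := Set.ext_iff.1 ((hcompat x r).trans (hxy r).symm) a
    exact ⟨fun h1 => (this.1 ⟨⟨ha.1, h1⟩, ha⟩).1.2, fun h1 => (this.2 ⟨⟨ha.1, h1⟩, ha⟩).1.2⟩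
  refine ⟨jβ, fun _ _ => rfl, huniq, fun j => ⟨fun hj => funext fun x => huniq x (j x) (hj x), ?_⟩⟩
  rintro rfl
  exact hcompat
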